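/- **Theorem (Asymmetric Orthonormal Subspace Sampling).** Let $W\in\mathbb R^{m\times d_1}$ and $V\in\mathbb R^{m\times d_2}$ have orthonormal columns, with rows $w_t^{\mathsf T}$ and $v_t^{\mathsf T}$ ($t=1,\dots,m$), and let $S_1\in\mathbb R^{d_1\times d_1}$, $S_2\in\mathbb R^{d_2\times d_2}$ be diagonal matrices with positive diagonal entries. Let $\|\cdot\|$ denote the spectral norm, $\|\cdot\|_F$ the Frobenius norm, and $\rho_i=\|S_i\|_F^2/\|S_i\|^2$ the stable rank of $S_i$. Let $\beta>0$, $0<\varepsilon\le 3\sqrt2$ and $\delta>0$, and let $p_1,\dots,p_m\ge 0$ with $\sum_t p_t=1$ satisfy $$p_t\ \ge\ \beta\,\frac{\frac{1}{\|S_1\|^2}\,w_t^{\mathsf T}S_1^2w_t+\frac{1}{\|S_2\|^2}\,v_t^{\mathsf T}S_2^2v_t}{\rho_1+\rho_2}\qquad(t=1,\dots,m).$$ Let $t_1,\dots,t_r$ be independent random indices with $\Pr[t_j=t]=p_t$ for every $j$ and $t$, and let $Q\in\mathbb R^{r\times m}$ be the random row-sampling matrix whose $j$-th row is $e_{t_j}^{\mathsf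 T}/\sqrt{r\,p_{t_j}}$, where $e_1,\dots,e_m$ is the standard basis of $\mathbb R^m$. If $$r\ \ge\ \frac{8(\rho_1+\rho_2)}{\beta\varepsilon^2}\,\ln\frac{2(d_1+d_2)}{\delta},$$ then with probability at least $1-\delta$, $$\bigl\|S_1W^{\mathsf T}VS_2-S_1W^{\mathsf T}Q^{\mathsf T}QVS_2\bigr\|\ \le\ \varepsilon\,\|S_1\|\,\|S_2\|.$$ -/

import Mathlib

open MeasureTheory ProbabilityTheory
open scoped Matrix

-- From here on `‖A‖` is the spectral norm (the operator norm for the Euclidean norms) of a matrix.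
open scoped Matrix.Norms.L2Operator

/-- A real matrix is orthonormal if its columns are orthonormal. -/
def IsOrthonormalMatrix {m d : ℕ} (U : Matrix (Fin m) (Fin d) ℝ) : Prop :=
  Uᵀ * U = 1

/-- A positive diagonal matrix: diagonal, with strictly positive diagonal entries. -/
def IsPositiveDiagonal {d : ℕ} (S : Matrix (Fin d) (Fin d) ℝ) : Prop :=
  S.IsDiag ∧ ∀ i, 0 < S i i

/-- The stable (numerical) rank: squared Frobenius norm over squared spectral norm. -/
noncomputable def stableRank {m d : ℕ} (A : Matrix (Fin m) (Fin d) ℝ) : ℝ :=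
  (∑ i, ∑ j, A i j ^ 2) / ‖A‖ ^ 2

/-- The row-sampling matrix of the sampled indices `t 0, …, t (r - 1)`: its `j`-th row is
the standard basis vector of index `t j`, rescaled by `1 / √(r * p (t j))`. -/
noncomputable def rowSamplingMatrix {m r : ℕ} (p : Fin m → ℝ) (t : Fin r → Fin m) :
    Matrix (Fin r) (Fin m) ℝ :=
  Matrix.of fun j => Pi.single (t j) (1 / √((r : ℝ) * p (t j)))

/-! Put `A = W S₁ / ‖S₁‖` and `B = V S₂ / ‖S₂‖`. The sampled product is the mean of `r` independent
copies of the rank-one matrix `a_t b_tᵀ / p_t`, whose expectation is `Aᵀ B`. With `L = (ρ₁ + ρ₂) /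
β`, the condition on `p` reads `|a_t|² + |b_t|² ≤ L p_t`. By AM-GM the centred estimator has norm at
most `L`. Since `AᵀA ≤ 1` and `BᵀB ≤ 1`, both of its variance matrices are at most `L`.

Concentration follows by the Ahlswede-Winter method. Hermitian dilation reduces to symmetric
summands, and the exponential Markov inequality reduces to bounding the expected trace of the
exponential of a random sum. Golden-Thompson (`Matrix.trace_exp_add_le`) peels off one summand at a
time, each costing a factor `exp v` because `exp x ≤ 1 + x + x²` on `[-1, 1]`. Golden-Thompson
itself is the limit, through the Lie product formula, of a trace inequality for powers of two that
rests on Cauchy-Schwarz. -/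

open Filter Topology

/-! ### Trace inequalities for powers of matrix products -/

section Trace
variable {n : Type*} [Fintype n]

lemma Matrix.trace_transpose_mul_sq_le {m : Type*} [Fintype m] (A B : Matrix m n ℝ) :
    (Aᵀ * B).trace ^ 2 ≤ (Aᵀ * A).trace * (Bᵀ * B).trace := by
  have h (X Y : Matrix m n ℝ) : (Xᵀ * Y).trace = ∑ q : n × m, X q.2 q.1 * Y q.2 q.1 := by
    simp [Matrix.trace, Matrix.mul_apply, Fintype.sum_prod_type]
  rw [h, h, h]
  simpa [sq] using Finset.sum_mul_sq_le_sq_mul_sq Finset.univ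
    (fun q : n × m => A q.2 q.1) (fun q => B q.2 q.1)

lemma Matrix.trace_transpose_mul_le_of_trace_eq {m : Type*} [Fintype m] (A B : Matrix m n ℝ)
    (h : (Bᵀ * B).trace = (Aᵀ * A).trace) : (Aᵀ * B).trace ≤ (Aᵀ * A).trace := by
  have h0 : 0 ≤ (Aᵀ * A).trace := by
    simp only [Matrix.trace, Matrix.diag, Matrix.mul_apply, Matrix.transpose_apply]
    exact Finset.sum_nonneg fun _ _ => Finset.sum_nonneg fun _ _ => mul_self_nonneg _
  have := Matrix.trace_transpose_mul_sq_le A B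
  rw [h, ← sq] at this
  exact (le_abs_self _).trans (abs_le_of_sq_le_sq this h0)

variable [DecidableEq n]

lemma Matrix.trace_mul_pow_comm (A B : Matrix n n ℝ) (k : ℕ) :
    ((A * B) ^ k).trace = ((B * A) ^ k).trace := by
  cases k with
  | zero => simp
  | succ k =>
    have h : (A * B) ^ (k + 1) = A * ((B * A) ^ k * B) := by
      induction k with
      | zero => simp
      | succ k ih => rw [pow_succ', ih, pow_succ' (B * A) k]; simp only [Matrix.mul_assoc]
    rw [h, Matrix.trace_mul_comm, pow_succ, Matrix.mul_assoc]

/-- The two claims feed each other in a joint induction. For the first, the old first claim at `X ^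
2` and cyclicity produce a power of `(X Xᵀ)(Xᵀ X)`; the old second claim separates the factors and
Cauchy-Schwarz merges them. For the second, the old first claim at `P * R` leads to the old second
claim at `P ^ 2`, `R ^ 2`. -/
lemma Matrix.trace_pow_two_pow_le_and (k : ℕ) :
    (∀ X : Matrix n n ℝ, (X ^ (2 * 2 ^ k)).trace ≤ ((Xᵀ * X) ^ 2 ^ k).trace) ∧
    ∀ P R : Matrix n n ℝ, P.IsSymm → R.IsSymm →
      ((P * R) ^ 2 ^ k).trace ≤ (P ^ 2 ^ k * R ^ 2 ^ k).trace := by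
  induction k with
  | zero =>
    refine ⟨fun X => ?_, fun P R _ _ => by simp⟩
    have := Matrix.trace_transpose_mul_le_of_trace_eq Xᵀ X (by
      rw [Matrix.transpose_transpose, Matrix.trace_mul_comm])
    rw [Matrix.transpose_transpose, Matrix.trace_mul_comm X Xᵀ] at this
    simpa [sq] using this
  | succ k ih =>
    obtain ⟨h1, h2⟩ := ih
    have e : 2 ^ (k + 1) = 2 * 2 ^ k := pow_succ' 2 k
    refine ⟨fun X => ?_, fun P R hP hR => ?_⟩
    · have hP : (X * Xᵀ).IsSymm := Matrix.isSymm_mul_transpose_self X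
      have hQ : (Xᵀ * X).IsSymm := Matrix.isSymm_transpose_mul_self X
      calc (X ^ (2 * 2 ^ (k + 1))).trace = ((X ^ 2) ^ (2 * 2 ^ k)).trace := by
            rw [← pow_mul, e]
        _ ≤ (((X ^ 2)ᵀ * X ^ 2) ^ 2 ^ k).trace := h1 _
        _ = (((X * Xᵀ) * (Xᵀ * X)) ^ 2 ^ k).trace := by
            have h := Matrix.trace_mul_pow_comm Xᵀ (Xᵀ * X * X) (2 ^ k)
            have h' := Matrix.trace_mul_pow_comm (Xᵀ * X) (X * Xᵀ) (2 ^ k)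
            simp only [sq, Matrix.transpose_mul, Matrix.mul_assoc] at h h' ⊢
            rw [h, h']
        _ ≤ ((X * Xᵀ) ^ 2 ^ k * (Xᵀ * X) ^ 2 ^ k).trace := h2 _ _ hP hQ
        _ ≤ ((Xᵀ * X) ^ 2 ^ (k + 1)).trace := by
            -- Powers of `X Xᵀ` and `Xᵀ X` have equal traces, so these two symmetric matrices have
            -- the same Frobenius norm.
            have h := Matrix.trace_transpose_mul_le_of_trace_eq
              ((X * Xᵀ) ^ 2 ^ k) ((Xᵀ * X) ^ 2 ^ k) (by
                rw [Matrix.transpose_pow, Matrix.transpose_pow, hP.eq, hQ.eq, ← pow_add, ← pow_add,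
                  Matrix.trace_mul_pow_comm])
            rw [Matrix.transpose_pow, hP.eq, ← pow_add, ← two_mul, ← e,
              Matrix.trace_mul_pow_comm X Xᵀ] at h
            exact h
    · calc ((P * R) ^ 2 ^ (k + 1)).trace = ((P * R) ^ (2 * 2 ^ k)).trace := by rw [e]
        _ ≤ (((P * R)ᵀ * (P * R)) ^ 2 ^ k).trace := h1 _
        _ = ((P ^ 2 * R ^ 2) ^ 2 ^ k).trace := by
            rw [Matrix.transpose_mul, hP.eq, hR.eq, Matrix.mul_assoc, Matrix.trace_mul_pow_comm]
            simp only [sq, Matrix.mul_assoc]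
        _ ≤ ((P ^ 2) ^ 2 ^ k * (R ^ 2) ^ 2 ^ k).trace :=
            h2 _ _ (by rw [Matrix.IsSymm, Matrix.transpose_pow, hP.eq])
              (by rw [Matrix.IsSymm, Matrix.transpose_pow, hR.eq])
        _ = _ := by rw [← pow_mul, ← pow_mul, ← e]
end Trace


/-! ### The Lie product formula and Golden-Thompson -/

section LieTrotter

/-- Telescoping, one factor at a time; `1 ≤ c` lets the exponent be rounded up to `k`. -/
lemma norm_pow_sub_pow_le_of_norm_le {A : Type*} [NormedRing A] [NormOneClass A] {a b : A} {c : ℝ}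
    (hc : 1 ≤ c) (ha : ‖a‖ ≤ c) (hb : ‖b‖ ≤ c) (k : ℕ) :
    ‖a ^ k - b ^ k‖ ≤ k * c ^ k * ‖a - b‖ := by
  induction k with
  | zero => simp
  | succ k ih =>
    have e : a ^ (k + 1) - b ^ (k + 1) = a ^ k * (a - b) + (a ^ k - b ^ k) * b := by
      rw [pow_succ, pow_succ]; noncomm_ring
    have h1 : ‖a ^ k * (a - b)‖ ≤ c ^ k * ‖a - b‖ :=
      (norm_mul_le _ _).trans (by gcongr; exact (norm_pow_le _ _).trans (by gcongr))
    have h2 : ‖(a ^ k - b ^ k) * b‖ ≤ ‖a ^ k - b ^ k‖ * c :=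
      (norm_mul_le _ _).trans (by gcongr)
    have h3 : c ^ k ≤ c ^ (k + 1) := pow_le_pow_right₀ hc k.le_succ
    calc _ ≤ c ^ k * ‖a - b‖ + ‖a ^ k - b ^ k‖ * c := by
          rw [e]; exact (norm_add_le _ _).trans (add_le_add h1 h2)
      _ ≤ c ^ (k + 1) * ‖a - b‖ + k * c ^ k * ‖a - b‖ * c := by gcongr
      _ = _ := by push_cast; ring

variable {A : Type*} [NormedRing A] [NormOneClass A] [NormedAlgebra ℝ A]

lemma eventually_norm_le_exp_of_hasDerivAt_zero {f : ℝ → A} {d : A} (hf : HasDerivAt f d 0)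
    (hf0 : f 0 = 1) : ∃ C : ℝ, ∀ᶠ s in 𝓝 (0 : ℝ), ‖f s‖ ≤ Real.exp (C * |s|) := by
  obtain ⟨C, hC⟩ := hf.isBigO_sub.bound
  refine ⟨C, ?_⟩
  filter_upwards [hC] with s hs
  rw [hf0, sub_zero, Real.norm_eq_abs] at hs
  calc ‖f s‖ = ‖(f s - 1) + 1‖ := by simp
    _ ≤ C * |s| + 1 := (norm_add_le _ _).trans (by rw [norm_one]; gcongr)
    _ ≤ _ := Real.add_one_le_exp _

/-- Curves through `1` with the same tangent differ by `o(1/k)` at `1/k`. Telescoping multiplies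
this by `k` and by a bounded factor, since norms at most `exp (M / k)` have `k`-th powers at most
`exp M`. -/
lemma tendsto_pow_sub_pow_of_hasDerivAt_zero {f g : ℝ → A} {d : A} (hf : HasDerivAt f d 0)
    (hg : HasDerivAt g d 0) (hf0 : f 0 = 1) (hg0 : g 0 = 1) :
    Tendsto (fun k : ℕ => f (k : ℝ)⁻¹ ^ k - g (k : ℝ)⁻¹ ^ k) atTop (𝓝 0) := by
  obtain ⟨C, hC⟩ := eventually_norm_le_exp_of_hasDerivAt_zero hf hf0
  obtain ⟨D, hD⟩ := eventually_norm_le_exp_of_hasDerivAt_zero hg hg0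
  have ht : Tendsto (fun k : ℕ => (k : ℝ)⁻¹) atTop (𝓝 0) := tendsto_inv_atTop_nhds_zero_nat
  have ho : Tendsto (fun k : ℕ => (k : ℝ) * ‖f (k : ℝ)⁻¹ - g (k : ℝ)⁻¹‖) atTop (𝓝 0) := by
    have h := (hf.sub hg).isLittleO
    simp only [Pi.sub_apply, hf0, hg0, sub_self, sub_zero, smul_zero] at h
    have := (h.comp_tendsto ht).norm_left.tendsto_div_nhds_zero
    refine this.congr fun k => ?_
    simp [div_eq_mul_inv, mul_comm]
  set M := max 0 (max C D)
  refine squeeze_zero_norm' (a := fun k : ℕ =>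
    Real.exp M * ((k : ℝ) * ‖f (k : ℝ)⁻¹ - g (k : ℝ)⁻¹‖)) ?_ (by simpa using ho.const_mul _)
  filter_upwards [ht.eventually hC, ht.eventually hD, eventually_gt_atTop 0] with k h1 h2 hk
  have hk' : (0 : ℝ) < k := by exact_mod_cast hk
  rw [abs_of_pos (inv_pos.2 hk')] at h1 h2
  have hc : Real.exp (M * (k : ℝ)⁻¹) ^ k = Real.exp M := by
    rw [← Real.exp_nat_mul]; congr 1; field_simp
  calc _ ≤ k * Real.exp (M * (k : ℝ)⁻¹) ^ k * ‖f (k : ℝ)⁻¹ - g (k : ℝ)⁻¹‖ := by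
        refine norm_pow_sub_pow_le_of_norm_le (Real.one_le_exp ?_) (h1.trans ?_) (h2.trans ?_) k
        · exact mul_nonneg (le_max_left _ _) (inv_pos.2 hk').le
        · gcongr; exact (le_max_left _ _).trans (le_max_right _ _)
        · gcongr; exact (le_max_right _ _).trans (le_max_right _ _)
    _ = _ := by rw [hc]; ring

/-- The **Lie product formula**. -/
theorem tendsto_exp_inv_smul_mul_exp_inv_smul_pow [CompleteSpace A] (H K : A) :
    Tendsto (fun k : ℕ => (NormedSpace.exp ((k : ℝ)⁻¹ • H) * NormedSpace.exp ((k : ℝ)⁻¹ • K)) ^ k)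
      atTop (𝓝 (NormedSpace.exp (H + K))) := by
  let _ : NormedAlgebra ℚ A := NormedAlgebra.restrictScalars ℚ ℝ A
  have hf : HasDerivAt (fun s : ℝ => NormedSpace.exp (s • H) * NormedSpace.exp (s • K))
      (H + K) 0 := by
    have h := (hasDerivAt_exp_smul_const H (0 : ℝ)).mul (hasDerivAt_exp_smul_const K (0 : ℝ))
    simp only [zero_smul, NormedSpace.exp_zero, one_mul, mul_one] at h
    exact h
  have hg : HasDerivAt (fun s : ℝ => NormedSpace.exp (s • (H + K))) (H + K) 0 := by
    simpa using hasDerivAt_exp_smul_const (H + K) (0 : ℝ)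
  have h := (tendsto_pow_sub_pow_of_hasDerivAt_zero hf hg (by simp) (by simp)).add_const
    (NormedSpace.exp (H + K))
  rw [zero_add] at h
  refine h.congr' ?_
  filter_upwards [eventually_gt_atTop 0] with k hk
  have hk' : (k : ℝ) ≠ 0 := by exact_mod_cast hk.ne'
  rw [← NormedSpace.exp_nsmul k ((k : ℝ)⁻¹ • (H + K)), ← Nat.cast_smul_eq_nsmul ℝ, smul_smul,
    mul_inv_cancel₀ hk', one_smul, sub_add_cancel]

end LieTrotter

/-- The **Golden-Thompson inequality** for real symmetric matrices. -/
theorem Matrix.trace_exp_add_le {n : Type*} [Fintype n] [DecidableEq n] {H K : Matrix n n ℝ}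
    (hH : H.IsSymm) (hK : K.IsSymm) :
    (NormedSpace.exp (H + K)).trace ≤ (NormedSpace.exp H * NormedSpace.exp K).trace := by
  cases isEmpty_or_nonempty n
  · simp [Matrix.trace]
  have : NormOneClass (Matrix n n ℝ) := inferInstance
  let _ : NormedAlgebra ℚ (Matrix n n ℝ) := NormedAlgebra.restrictScalars ℚ ℝ _
  -- Only the exponents `2 ^ k` are needed, and those are the ones covered by the trace inequality.
  have h := (tendsto_exp_inv_smul_mul_exp_inv_smul_pow H K).comp
    (tendsto_pow_atTop_atTop_of_one_lt (one_lt_two (α := ℕ)))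
  have ht := ((continuous_id.matrix_trace).tendsto (NormedSpace.exp (H + K))).comp h
  refine le_of_tendsto ht (Eventually.of_forall fun k => ?_)
  have e (Z : Matrix n n ℝ) : NormedSpace.exp (((2 ^ k : ℕ) : ℝ)⁻¹ • Z) ^ 2 ^ k
      = NormedSpace.exp Z := by
    rw [← NormedSpace.exp_nsmul, ← Nat.cast_smul_eq_nsmul ℝ, smul_smul,
      mul_inv_cancel₀ (by positivity), one_smul]
  have := (Matrix.trace_pow_two_pow_le_and (n := n) k).2
    (NormedSpace.exp (((2 ^ k : ℕ) : ℝ)⁻¹ • H)) (NormedSpace.exp (((2 ^ k : ℕ) : ℝ)⁻¹ • K))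
    ((hH.smul _).exp) ((hK.smul _).exp)
  rwa [e, e] at this

/-! ### Matrix Bernstein inequality by the Ahlswede-Winter method -/

section Bernstein
open scoped MatrixOrder
variable {n : Type*} [Fintype n] [DecidableEq n]

/-- The spectrum lies in `[-1, 1]`, so functional calculus transfers the scalar inequality. -/
lemma Matrix.exp_le_one_add_self_add_sq {Y : Matrix n n ℝ} (hY : Y.IsHermitian) (h : ‖Y‖ ≤ 1) :
    NormedSpace.exp Y ≤ 1 + Y + Y ^ 2 := by
  have hs : IsSelfAdjoint Y := hY
  have e : cfc (fun x : ℝ => 1 + x + x ^ 2) Y = 1 + Y + Y ^ 2 := by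
    rw [cfc_add (a := Y) (fun x : ℝ => 1 + x) (fun x => x ^ 2),
      cfc_add (a := Y) (fun _ : ℝ => 1) (fun x => x), cfc_const_one ℝ Y, cfc_id' ℝ Y, cfc_pow_id Y 2]
  rw [← CFC.real_exp_eq_normedSpace_exp hs, ← e]
  refine cfc_mono fun x hx => ?_
  have hx1 : |x| ≤ 1 := by
    have := norm_apply_le_norm_cfc (fun x : ℝ => x) Y hx
    rw [cfc_id' ℝ Y] at this
    exact this.trans h
  linarith [(abs_le.1 (Real.abs_exp_sub_one_sub_id_le hx1)).2]

/-- Writing `P = C* C`, the difference is the trace of the positive semidefinite matrix `C (c - M)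
C*`. -/
lemma Matrix.trace_mul_le_of_le_smul_one {P M : Matrix n n ℝ} {c : ℝ} (hP : 0 ≤ P)
    (hM : M ≤ c • 1) : (P * M).trace ≤ c * P.trace := by
  obtain ⟨C, rfl⟩ := (CStarAlgebra.nonneg_iff_eq_star_mul_self).1 hP
  have h := ((Matrix.le_iff.1 hM).mul_mul_conjTranspose_same C).trace_nonneg
  rw [Matrix.mul_sub, Matrix.sub_mul, Matrix.trace_sub, Matrix.trace_mul_cycle C M] at h
  rw [Matrix.mul_smul, Matrix.mul_one, Matrix.smul_mul, Matrix.trace_smul,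
    Matrix.trace_mul_comm] at h
  rw [star_eq_conjTranspose]
  simpa using h

lemma Matrix.IsHermitian.trace_exp_eq_sum {D : Matrix n n ℝ} (hD : D.IsHermitian) :
    (NormedSpace.exp D).trace = ∑ i, Real.exp (hD.eigenvalues i) := by
  rw [← CFC.real_exp_eq_normedSpace_exp (show IsSelfAdjoint D from hD), hD.cfc_eq,
    Matrix.IsHermitian.cfc, Unitary.conjStarAlgAut_apply, Matrix.trace_mul_cycle]
  simp [Matrix.trace]

lemma Matrix.IsHermitian.exp_le_trace_exp {D : Matrix n n ℝ} (hD : D.IsHermitian) {x : ℝ}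
    (hx : x ∈ spectrum ℝ D) : Real.exp x ≤ (NormedSpace.exp D).trace := by
  rw [hD.spectrum_real_eq_range_eigenvalues] at hx
  obtain ⟨i, rfl⟩ := hx
  rw [hD.trace_exp_eq_sum]
  exact Finset.single_le_sum (f := fun i => Real.exp (hD.eigenvalues i))
    (fun _ _ => (Real.exp_pos _).le) (Finset.mem_univ i)

/-- The norm is governed by the largest `|x|` in the spectrum; `exp |x|` is a term of one of the two
traces, according to the sign of `x`. -/
lemma Matrix.IsHermitian.exp_norm_le_trace [Nonempty n] {D : Matrix n n ℝ} (hD : D.IsHermitian) :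
    Real.exp ‖D‖ ≤ (NormedSpace.exp D).trace + (NormedSpace.exp (-D)).trace := by
  have hs : IsSelfAdjoint D := hD
  set T := (NormedSpace.exp D).trace + (NormedSpace.exp (-D)).trace with hT
  have key : ∀ x ∈ spectrum ℝ D, |x| ≤ Real.log T := by
    intro x hx
    have h1 := hD.exp_le_trace_exp hx
    have h2 := hD.neg.exp_le_trace_exp (x := -x) (by rw [← spectrum.neg_eq]; simpa using hx)
    have p1 := Real.exp_pos x
    have p2 := Real.exp_pos (-x)
    rw [Real.le_log_iff_exp_le (by linarith)]
    rcases abs_cases x with ⟨h, _⟩ | ⟨h, _⟩ <;> rw [h] <;> linarith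
  obtain ⟨x, hx⟩ : (spectrum ℝ D).Nonempty := by
    rw [hD.spectrum_real_eq_range_eigenvalues]; exact Set.range_nonempty _
  have hT0 : 0 < T := by
    rw [hT, hD.trace_exp_eq_sum, hD.neg.trace_exp_eq_sum]; positivity
  have : ‖D‖ ≤ Real.log T := by
    conv_lhs => rw [← cfc_id' ℝ D]
    exact norm_cfc_le ((abs_nonneg x).trans (key x hx)) key
  rwa [Real.le_log_iff_exp_le hT0] at this

variable {ι : Type*} [Fintype ι]

/-- Centring kills the linear term of the quadratic bound, and `1 + v ≤ exp v`. -/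
lemma Matrix.sum_smul_exp_le {p : ι → ℝ} {Y : ι → Matrix n n ℝ} {v : ℝ} (hp : ∀ i, 0 ≤ p i)
    (hp1 : ∑ i, p i = 1) (hY : ∀ i, (Y i).IsHermitian) (hY1 : ∀ i, ‖Y i‖ ≤ 1)
    (hY0 : ∑ i, p i • Y i = 0) (hv : ∑ i, p i • Y i ^ 2 ≤ v • 1) :
    ∑ i, p i • NormedSpace.exp (Y i) ≤ Real.exp v • (1 : Matrix n n ℝ) := by
  calc ∑ i, p i • NormedSpace.exp (Y i) ≤ ∑ i, p i • (1 + Y i + Y i ^ 2) :=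
        Finset.sum_le_sum fun i _ =>
          smul_le_smul_of_nonneg_left (Matrix.exp_le_one_add_self_add_sq (hY i) (hY1 i)) (hp i)
    _ = 1 + ∑ i, p i • Y i ^ 2 := by
        simp only [smul_add, Finset.sum_add_distrib, hY0, add_zero, ← Finset.sum_smul, hp1, one_smul]
    _ ≤ 1 + v • 1 := by gcongr
    _ = (v + 1) • 1 := by rw [add_smul, one_smul, add_comm]
    _ ≤ _ := smul_le_smul_of_nonneg_right (Real.add_one_le_exp v) zero_le_one

/-- The sum over tuples is an expectation over `r` independent samples. A general `A` lets the
induction absorb the first sample into it; Golden-Thompson then detaches that sample from `exp A`,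
and averaging costs `exp v`. -/
theorem Matrix.sum_prod_mul_trace_exp_add_sum_le {p : ι → ℝ} {Y : ι → Matrix n n ℝ} {v : ℝ}
    (hp : ∀ i, 0 ≤ p i) (hp1 : ∑ i, p i = 1) (hY : ∀ i, (Y i).IsHermitian)
    (hY1 : ∀ i, ‖Y i‖ ≤ 1) (hY0 : ∑ i, p i • Y i = 0) (hv : ∑ i, p i • Y i ^ 2 ≤ v • 1)
    (r : ℕ) (A : Matrix n n ℝ) (hA : A.IsHermitian) :
    ∑ t : Fin r → ι, (∏ j, p (t j)) * (NormedSpace.exp (A + ∑ j, Y (t j))).trace ≤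
      Real.exp (r * v) * (NormedSpace.exp A).trace := by
  induction r generalizing A with
  | zero => simp
  | succ r ih =>
    rw [← (Fin.consEquiv fun _ => ι).sum_comp, Fintype.sum_prod_type]
    simp only [Fin.consEquiv_apply, Fin.prod_univ_succ, Fin.sum_univ_succ, Fin.cons_zero,
      Fin.cons_succ, ← add_assoc, mul_assoc, ← Finset.mul_sum]
    have hstep : ∑ i, p i * (NormedSpace.exp (A + Y i)).trace
        ≤ Real.exp v * (NormedSpace.exp A).trace := by
      calc _ ≤ ∑ i, p i * (NormedSpace.exp A * NormedSpace.exp (Y i)).trace := by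
            gcongr with i
            · exact hp i
            · exact Matrix.trace_exp_add_le (by simpa using hA) (by simpa using hY i)
        _ = (NormedSpace.exp A * ∑ i, p i • NormedSpace.exp (Y i)).trace := by
            simp [Finset.mul_sum, Matrix.trace_sum, Matrix.trace_smul]
        _ ≤ _ := Matrix.trace_mul_le_of_le_smul_one (IsSelfAdjoint.exp_nonneg hA)
            (Matrix.sum_smul_exp_le hp hp1 hY hY1 hY0 hv)
    calc _ ≤ ∑ i, p i * (Real.exp (r * v) * (NormedSpace.exp (A + Y i)).trace) := by
          gcongr with i
          · exact hp i
          · exact ih (A + Y i) (hA.add (hY i))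
      _ = Real.exp (r * v) * ∑ i, p i * (NormedSpace.exp (A + Y i)).trace := by
          rw [Finset.mul_sum]; exact Finset.sum_congr rfl fun _ _ => by ring
      _ ≤ Real.exp (r * v) * (Real.exp v * (NormedSpace.exp A).trace) := by gcongr
      _ = _ := by rw [← mul_assoc, ← Real.exp_add]; push_cast; ring_nf

/-- A **matrix Bernstein inequality** for independent samples from a finite distribution. -/
theorem Matrix.sum_prod_filter_norm_sum_le {p : ι → ℝ} {Y : ι → Matrix n n ℝ} {v : ℝ}
    (hp : ∀ i, 0 ≤ p i) (hp1 : ∑ i, p i = 1) (hY : ∀ i, (Y i).IsHermitian)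
    (hY1 : ∀ i, ‖Y i‖ ≤ 1) (hY0 : ∑ i, p i • Y i = 0) (hv : ∑ i, p i • Y i ^ 2 ≤ v • 1)
    [Nonempty n] (r : ℕ) (τ : ℝ) :
    ∑ t : Fin r → ι with τ < ‖∑ j, Y (t j)‖, ∏ j, p (t j) ≤
      2 * Fintype.card n * Real.exp (r * v - τ) := by
  have hprod (t : Fin r → ι) : 0 ≤ ∏ j, p (t j) := Finset.prod_nonneg fun _ _ => hp _
  -- Both signs are needed to control the norm; starting from `A = 0` contributes the trace of `1`,
  -- which is the dimension.
  have hneg := Matrix.sum_prod_mul_trace_exp_add_sum_le (Y := fun i => -Y i) hp hp1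
    (fun i => (hY i).neg) (by simpa using hY1) (by simpa using hY0) (by simpa using hv) r 0
    Matrix.isHermitian_zero
  have hpos := Matrix.sum_prod_mul_trace_exp_add_sum_le hp hp1 hY hY1 hY0 hv r 0
    Matrix.isHermitian_zero
  simp only [zero_add, NormedSpace.exp_zero, Matrix.trace_one, Finset.sum_neg_distrib]
    at hneg hpos
  have hH (t : Fin r → ι) : (∑ j, Y (t j)).IsHermitian :=
    isSelfAdjoint_sum _ fun j _ => hY (t j)
  -- Exponential Markov: the indicator of `τ < x` is at most `exp (x - τ)`.
  calc _ ≤ ∑ t : Fin r → ι, (∏ j, p (t j)) *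
        (Real.exp (-τ) * Real.exp ‖∑ j, Y (t j)‖) := by
        rw [Finset.sum_filter]
        refine Finset.sum_le_sum fun t _ => ?_
        rw [← Real.exp_add]
        split_ifs with h
        · exact le_mul_of_one_le_right (hprod t) (Real.one_le_exp (by linarith))
        · exact mul_nonneg (hprod t) (Real.exp_pos _).le
    _ ≤ ∑ t : Fin r → ι, (∏ j, p (t j)) * (Real.exp (-τ) *
        ((NormedSpace.exp (∑ j, Y (t j))).trace + (NormedSpace.exp (-∑ j, Y (t j))).trace)) := by
        gcongr with t
        · exact hprod t
        · exact (hH t).exp_norm_le_trace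
    _ = Real.exp (-τ) * (∑ t : Fin r → ι, (∏ j, p (t j)) * (NormedSpace.exp (∑ j, Y (t j))).trace
        + ∑ t : Fin r → ι, (∏ j, p (t j)) * (NormedSpace.exp (-∑ j, Y (t j))).trace) := by
        rw [← Finset.sum_add_distrib, Finset.mul_sum]
        exact Finset.sum_congr rfl fun _ _ => by ring
    _ ≤ Real.exp (-τ) * (Real.exp (r * v) * Fintype.card n + Real.exp (r * v) * Fintype.card n) := by
        gcongr
    _ = _ := by rw [sub_eq_add_neg, Real.exp_add]; ring

end Bernstein

/-- The joint law is the product measure, so the weighted sums over tuples bounded above are genuine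
probabilities. -/
lemma ProbabilityTheory.iIndepFun.measureReal_mem_eq_sum {Ω ι κ : Type*} [MeasurableSpace Ω]
    {μ : Measure Ω} [IsProbabilityMeasure μ] [Fintype ι] [Fintype κ] [MeasurableSpace κ]
    [MeasurableSingletonClass κ] [DecidableEq ι]
    {T : ι → Ω → κ} (hT : ∀ j, Measurable (T j)) (h : iIndepFun T μ) (s : Finset (ι → κ)) :
    μ.real {ω | (fun j => T j ω) ∈ s} = ∑ t ∈ s, ∏ j, μ.real {ω | T j ω = t j} := by
  have hm : Measurable fun ω j => T j ω := measurable_pi_lambda _ hT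
  have h1 : μ.real {ω | (fun j => T j ω) ∈ s} = (μ.map fun ω j => T j ω).real s := by
    rw [map_measureReal_apply hm s.measurableSet]; rfl
  rw [h1, ← sum_measureReal_singleton]
  refine Finset.sum_congr rfl fun t _ => ?_
  rw [h.map_fun_eq_pi_map fun i => (hT i).aemeasurable, measureReal_def, Measure.pi_singleton,
    ENNReal.toReal_prod]
  refine Finset.prod_congr rfl fun j _ => ?_
  rw [Measure.map_apply (hT j) (measurableSet_singleton _)]; rfl

lemma dotProduct_self_nonneg_real {m : Type*} [Fintype m] (x : m → ℝ) : 0 ≤ x ⬝ᵥ x :=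
  Finset.sum_nonneg fun _ _ => mul_self_nonneg _

/-! ### Spectral norm bounds through quadratic forms -/

section OpNorm
variable {m n : Type*} [Fintype m] [Fintype n] [DecidableEq n]

lemma Matrix.mulVec_dotProduct_mulVec_le (A : Matrix m n ℝ) (x : n → ℝ) :
    (A *ᵥ x) ⬝ᵥ (A *ᵥ x) ≤ ‖A‖ ^ 2 * (x ⬝ᵥ x) := by
  have h := pow_le_pow_left₀ (norm_nonneg _) (A.l2_opNorm_mulVec (WithLp.toLp 2 x)) 2
  rw [mul_pow, EuclideanSpace.real_norm_sq_eq, EuclideanSpace.real_norm_sq_eq] at h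
  simpa [dotProduct, ← sq] using h

lemma Matrix.l2_opNorm_le_of_mulVec_dotProduct_le {A : Matrix m n ℝ} {c : ℝ} (hc : 0 ≤ c)
    (h : ∀ x, (A *ᵥ x) ⬝ᵥ (A *ᵥ x) ≤ c ^ 2 * (x ⬝ᵥ x)) : ‖A‖ ≤ c := by
  rw [Matrix.l2_opNorm_def]
  refine ContinuousLinearMap.opNorm_le_bound _ hc fun x => ?_
  refine le_of_sq_le_sq ?_ (by positivity)
  rw [mul_pow, EuclideanSpace.real_norm_sq_eq, EuclideanSpace.real_norm_sq_eq]
  simpa [dotProduct, ← sq, Matrix.ofLp_toLpLin] using h x.ofLp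

lemma Matrix.l2_opNorm_vecMulVec_le (a : m → ℝ) (b : n → ℝ) {c : ℝ} (hc : 0 ≤ c)
    (h : (a ⬝ᵥ a) * (b ⬝ᵥ b) ≤ c ^ 2) : ‖Matrix.vecMulVec a b‖ ≤ c := by
  refine Matrix.l2_opNorm_le_of_mulVec_dotProduct_le hc fun x => ?_
  have e : Matrix.vecMulVec a b *ᵥ x = (b ⬝ᵥ x) • a := by
    rw [Matrix.vecMulVec_mulVec]; simp
  have cs : (b ⬝ᵥ x) ^ 2 ≤ (b ⬝ᵥ b) * (x ⬝ᵥ x) := by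
    simpa [dotProduct, sq] using Finset.sum_mul_sq_le_sq_mul_sq Finset.univ b x
  have ha : 0 ≤ a ⬝ᵥ a := dotProduct_self_nonneg_real a
  have hx : 0 ≤ x ⬝ᵥ x := dotProduct_self_nonneg_real x
  rw [e, smul_dotProduct, dotProduct_smul, smul_eq_mul, smul_eq_mul]
  calc _ = (b ⬝ᵥ x) ^ 2 * (a ⬝ᵥ a) := by ring
    _ ≤ (b ⬝ᵥ b) * (x ⬝ᵥ x) * (a ⬝ᵥ a) := by gcongr
    _ = (a ⬝ᵥ a) * (b ⬝ᵥ b) * (x ⬝ᵥ x) := by ring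
    _ ≤ _ := by gcongr
end OpNorm

/-! ### Hermitian dilation of rectangular matrices -/

section Dilation
variable {m n : Type*}

/-- The Hermitian dilation of a rectangular real matrix. -/
def Matrix.hermitianDilation : Matrix m n ℝ →ₗ[ℝ] Matrix (m ⊕ n) (m ⊕ n) ℝ where
  toFun Z := Matrix.fromBlocks 0 Z Zᵀ 0
  map_add' X Y := by simp [Matrix.fromBlocks_add]
  map_smul' c X := by simp [Matrix.fromBlocks_smul]

lemma Matrix.hermitianDilation_apply (Z : Matrix m n ℝ) :
    Matrix.hermitianDilation Z = Matrix.fromBlocks 0 Z Zᵀ 0 := rfl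

lemma Matrix.isHermitian_hermitianDilation (Z : Matrix m n ℝ) :
    (Matrix.hermitianDilation Z).IsHermitian := by
  simp [Matrix.hermitianDilation_apply, Matrix.IsHermitian, Matrix.fromBlocks_transpose]

variable [Fintype m] [Fintype n] [DecidableEq m] [DecidableEq n]

/-- Squaring puts the row and column variances in separate diagonal blocks, so they can be bounded
independently. -/
lemma Matrix.hermitianDilation_sq (Z : Matrix m n ℝ) :
    Matrix.hermitianDilation Z ^ 2 = Matrix.fromBlocks (Z * Zᵀ) 0 0 (Zᵀ * Z) := by
  simp [Matrix.hermitianDilation_apply, sq, Matrix.fromBlocks_multiply]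

lemma Matrix.l2_opNorm_transpose (Z : Matrix m n ℝ) : ‖Zᵀ‖ = ‖Z‖ := by
  simpa using Matrix.l2_opNorm_conjTranspose Z

lemma Matrix.norm_hermitianDilation_le (Z : Matrix m n ℝ) :
    ‖Matrix.hermitianDilation Z‖ ≤ ‖Z‖ := by
  refine Matrix.l2_opNorm_le_of_mulVec_dotProduct_le (norm_nonneg _) fun x => ?_
  have h1 := Z.mulVec_dotProduct_mulVec_le (x ∘ Sum.inr)
  have h2 := Zᵀ.mulVec_dotProduct_mulVec_le (x ∘ Sum.inl)
  rw [Matrix.l2_opNorm_transpose] at h2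
  have e : x = Sum.elim (x ∘ Sum.inl) (x ∘ Sum.inr) := by simp
  rw [e]
  simp only [Matrix.hermitianDilation_apply, Matrix.fromBlocks_mulVec,
    Matrix.zero_mulVec, zero_add, add_zero, Sum.elim_comp_inl, Sum.elim_comp_inr,
    sumElim_dotProduct_sumElim]
  linarith

/-- Vectors supported on the second block already detect `Z`. -/
lemma Matrix.norm_le_norm_hermitianDilation (Z : Matrix m n ℝ) :
    ‖Z‖ ≤ ‖Matrix.hermitianDilation Z‖ := by
  refine Matrix.l2_opNorm_le_of_mulVec_dotProduct_le (norm_nonneg _) fun x => ?_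
  have h := (Matrix.hermitianDilation Z).mulVec_dotProduct_mulVec_le (Sum.elim 0 x)
  simpa [Matrix.hermitianDilation_apply, Matrix.fromBlocks_mulVec] using h

open scoped MatrixOrder in
lemma Matrix.fromBlocks_le_smul_one {P : Matrix m m ℝ} {R : Matrix n n ℝ} {c : ℝ}
    (hP : P ≤ c • 1) (hR : R ≤ c • 1) : Matrix.fromBlocks P 0 0 R ≤ c • 1 := by
  rw [Matrix.le_iff] at *
  have e : c • 1 - Matrix.fromBlocks P 0 0 R
      = Matrix.fromBlocks (c • 1 - P) 0 0 (c • 1 - R) := by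
    rw [← Matrix.fromBlocks_one, Matrix.fromBlocks_smul, sub_eq_add_neg, Matrix.fromBlocks_neg,
      Matrix.fromBlocks_add]
    simp [sub_eq_add_neg]
  rw [e]
  refine .of_dotProduct_mulVec_nonneg ?_ fun x => ?_
  · have h1 := hP.1
    have h2 := hR.1
    rw [Matrix.IsHermitian, Matrix.fromBlocks_conjTranspose, h1.eq, h2.eq]
    simp
  · have e : x = Sum.elim (x ∘ Sum.inl) (x ∘ Sum.inr) := by simp
    rw [e]
    simp only [Matrix.fromBlocks_mulVec, star_trivial, sumElim_dotProduct_sumElim,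
      Matrix.zero_mulVec, zero_add, add_zero, Sum.elim_comp_inl, Sum.elim_comp_inr]
    exact add_nonneg (hP.dotProduct_mulVec_nonneg _) (hR.dotProduct_mulVec_nonneg _)
end Dilation

/-! ### Range, variance and concentration of the row estimator -/

section Sampling
open scoped MatrixOrder
variable {ι m n : Type*}

/-- The estimator of `Aᵀ * B` from the single row index `t`, sampled with probability `p t`. -/
noncomputable def rowEstimator (p : ι → ℝ) (A : Matrix ι m ℝ) (B : Matrix ι n ℝ) (t : ι) :
    Matrix m n ℝ :=
  (p t)⁻¹ • Matrix.vecMulVec (A.row t) (B.row t)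

lemma rowEstimator_transpose (p : ι → ℝ) (A : Matrix ι m ℝ) (B : Matrix ι n ℝ) (t : ι) :
    (rowEstimator p A B t)ᵀ = rowEstimator p B A t := by
  simp [rowEstimator, Matrix.transpose_vecMulVec]

lemma Matrix.sum_vecMulVec_rows [Fintype ι] (A : Matrix ι m ℝ) (B : Matrix ι n ℝ) :
    ∑ t, Matrix.vecMulVec (A.row t) (B.row t) = Aᵀ * B := by
  ext i j; simp [Matrix.sum_apply, Matrix.mul_apply, Matrix.vecMulVec_apply]

variable {p : ι → ℝ} {A : Matrix ι m ℝ} {B : Matrix ι n ℝ} {L : ℝ}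

variable [Fintype m] [Fintype n]

lemma smul_rowEstimator (h : ∀ t, (A.row t ⬝ᵥ A.row t) + (B.row t ⬝ᵥ B.row t) ≤ L * p t) (t : ι) :
    p t • rowEstimator p A B t = Matrix.vecMulVec (A.row t) (B.row t) := by
  -- A row of probability zero must vanish in `A`, so the value `0⁻¹ = 0` introduces no bias.
  by_cases h0 : p t = 0
  · have h1 := h t
    rw [h0, mul_zero] at h1
    have h2 : A.row t ⬝ᵥ A.row t = 0 := by
      linarith [dotProduct_self_nonneg_real (A.row t), dotProduct_self_nonneg_real (B.row t)]
    rw [dotProduct_self_eq_zero] at h2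
    rw [h0, h2, zero_smul, Matrix.zero_vecMulVec]
  · rw [rowEstimator, smul_smul, mul_inv_cancel₀ h0, one_smul]

/-- AM-GM: `|a| |b| ≤ (|a|² + |b|²) / 2 ≤ L p_t / 2`. -/
lemma norm_rowEstimator_le [DecidableEq n] (hp : ∀ t, 0 ≤ p t) (hL : 0 ≤ L)
    (h : ∀ t, (A.row t ⬝ᵥ A.row t) + (B.row t ⬝ᵥ B.row t) ≤ L * p t) (t : ι) :
    ‖rowEstimator p A B t‖ ≤ L / 2 := by
  have hn : ‖Matrix.vecMulVec (A.row t) (B.row t)‖ ≤ L * p t / 2 := by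
    refine Matrix.l2_opNorm_vecMulVec_le _ _ (by have := hp t; positivity) ?_
    have h1 := dotProduct_self_nonneg_real (A.row t)
    have h2 := dotProduct_self_nonneg_real (B.row t)
    have h3 := pow_le_pow_left₀ (add_nonneg h1 h2) (h t) 2
    nlinarith [sq_nonneg ((A.row t ⬝ᵥ A.row t) - (B.row t ⬝ᵥ B.row t))]
  rw [rowEstimator, norm_smul, norm_inv, Real.norm_of_nonneg (hp t)]
  rcases (hp t).eq_or_lt with h0 | h0
  · simpa [← h0] using by linarith
  · rw [inv_mul_le_iff₀ h0]; linarith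

lemma smul_rowEstimator_mul_transpose_le (hp : ∀ t, 0 ≤ p t)
    (h : ∀ t, (A.row t ⬝ᵥ A.row t) + (B.row t ⬝ᵥ B.row t) ≤ L * p t) (hL : 0 ≤ L) (t : ι) :
    p t • (rowEstimator p A B t * (rowEstimator p A B t)ᵀ)
      ≤ L • Matrix.vecMulVec (A.row t) (A.row t) := by
  have hpos : (0 : Matrix m m ℝ) ≤ Matrix.vecMulVec (A.row t) (A.row t) := by
    rw [Matrix.nonneg_iff_posSemidef]
    simpa using Matrix.posSemidef_vecMulVec_self_star (A.row t)
  have e : p t • (rowEstimator p A B t * (rowEstimator p A B t)ᵀ)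
      = ((p t)⁻¹ * (B.row t ⬝ᵥ B.row t)) • Matrix.vecMulVec (A.row t) (A.row t) := by
    rw [← Matrix.smul_mul, smul_rowEstimator h, rowEstimator_transpose, rowEstimator, Matrix.mul_smul,
      Matrix.vecMulVec_mul_vecMulVec, mul_smul]
    simp [Matrix.vecMulVec_smul]
  rw [e]
  refine smul_le_smul_of_nonneg_right ?_ hpos
  rcases (hp t).eq_or_lt with h0 | h0
  · simpa [← h0] using hL
  · rw [inv_mul_le_iff₀ h0]; linarith [h t, dotProduct_self_nonneg_real (A.row t)]

variable [Fintype ι]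

lemma sum_smul_rowEstimator (h : ∀ t, (A.row t ⬝ᵥ A.row t) + (B.row t ⬝ᵥ B.row t) ≤ L * p t) :
    ∑ t, p t • rowEstimator p A B t = Aᵀ * B := by
  simp only [smul_rowEstimator h, Matrix.sum_vecMulVec_rows]

/-- The mean is a convex combination of estimators, so it obeys the same bound `L / 2`. -/
lemma norm_sub_rowEstimator_le [DecidableEq n] (hp : ∀ t, 0 ≤ p t) (hp1 : ∑ t, p t = 1)
    (hL : 0 ≤ L) (h : ∀ t, (A.row t ⬝ᵥ A.row t) + (B.row t ⬝ᵥ B.row t) ≤ L * p t) (t : ι) :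
    ‖Aᵀ * B - rowEstimator p A B t‖ ≤ L := by
  have h1 : ‖Aᵀ * B‖ ≤ L / 2 := by
    rw [← sum_smul_rowEstimator h]
    calc _ ≤ ∑ t, p t * (L / 2) := norm_sum_le_of_le _ fun t _ => by
          rw [norm_smul, Real.norm_of_nonneg (hp t)]
          exact mul_le_mul_of_nonneg_left (norm_rowEstimator_le hp hL h t) (hp t)
      _ = L / 2 := by rw [← Finset.sum_mul, hp1, one_mul]
  linarith [norm_sub_le (Aᵀ * B) (rowEstimator p A B t), norm_rowEstimator_le hp hL h t]

/-- The variance is the second moment minus `M Mᵀ`, and the second moment is at most `L AᵀA ≤ L`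
because `|b_t|² ≤ L p_t`. -/
lemma sum_smul_sub_rowEstimator_mul_transpose_le [DecidableEq m] (hp : ∀ t, 0 ≤ p t)
    (hp1 : ∑ t, p t = 1) (h : ∀ t, (A.row t ⬝ᵥ A.row t) + (B.row t ⬝ᵥ B.row t) ≤ L * p t) (hL : 0 ≤ L)
    (hA : Aᵀ * A ≤ 1) :
    ∑ t, p t • ((Aᵀ * B - rowEstimator p A B t) * (Aᵀ * B - rowEstimator p A B t)ᵀ) ≤ L • 1 := by
  set M := Aᵀ * B with hM
  have hs : ∑ t, p t • rowEstimator p A B t = M := sum_smul_rowEstimator h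
  have hMM : 0 ≤ M * Mᵀ := by
    rw [Matrix.nonneg_iff_posSemidef]
    simpa using Matrix.posSemidef_self_mul_conjTranspose M
  have e : ∑ t, p t • ((M - rowEstimator p A B t) * (M - rowEstimator p A B t)ᵀ)
      = ∑ t, p t • (rowEstimator p A B t * (rowEstimator p A B t)ᵀ) - M * Mᵀ := by
    have e1 : ∑ t, p t • (M * (rowEstimator p A B t)ᵀ) = M * Mᵀ := by
      simp_rw [← Matrix.mul_smul, ← Matrix.transpose_smul, ← Matrix.mul_sum, ← Matrix.transpose_sum, hs]
    have e2 : ∑ t, p t • (rowEstimator p A B t * Mᵀ) = M * Mᵀ := by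
      simp_rw [← Matrix.smul_mul, ← Matrix.sum_mul, hs]
    simp only [Matrix.transpose_sub, Matrix.mul_sub, Matrix.sub_mul, smul_sub,
      Finset.sum_sub_distrib, e1, e2, ← Finset.sum_smul, hp1, one_smul]
    abel
  calc _ ≤ ∑ t, p t • (rowEstimator p A B t * (rowEstimator p A B t)ᵀ) := by
        rw [e]; exact sub_le_self _ hMM
    _ ≤ ∑ t, L • Matrix.vecMulVec (A.row t) (A.row t) :=
        Finset.sum_le_sum fun t _ => smul_rowEstimator_mul_transpose_le hp h hL t
    _ = L • (Aᵀ * A) := by rw [← Finset.smul_sum, Matrix.sum_vecMulVec_rows]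
    _ ≤ L • 1 := smul_le_smul_of_nonneg_left hA hL

theorem sum_prod_filter_norm_sub_average_le [DecidableEq m] [DecidableEq n] [Nonempty m]
    (hp : ∀ t, 0 ≤ p t)
    (hp1 : ∑ t, p t = 1) (h : ∀ t, (A.row t ⬝ᵥ A.row t) + (B.row t ⬝ᵥ B.row t) ≤ L * p t) (hL : 0 < L)
    (hA : Aᵀ * A ≤ 1) (hB : Bᵀ * B ≤ 1) {ε δ : ℝ} (hε : 0 < ε) (hε5 : ε ≤ 5) (hδ : 0 < δ) {r : ℕ}
    (hr0 : 0 < r)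
    (hr : 8 * L / ε ^ 2 * Real.log (2 * ((Fintype.card m : ℝ) + Fintype.card n) / δ) ≤ r) :
    ∑ t : Fin r → ι with ε < ‖Aᵀ * B - (r : ℝ)⁻¹ • ∑ j, rowEstimator p A B (t j)‖, ∏ j, p (t j)
      ≤ δ := by
  -- This scaling gives `θ L = ε / 5 ≤ 1`, as Bernstein requires. The exponent becomes `r (θ² L - θ
  -- ε) = -(4/25) r ε² / L`, and `4/25 ≥ 1/8` matches the constant 8 in the sample size.
  set θ := ε / (5 * L) with hθ
  have hθ0 : 0 < θ := by positivity
  have hr' : (0 : ℝ) < r := by exact_mod_cast hr0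
  set Z : ι → Matrix m n ℝ := fun t => Aᵀ * B - rowEstimator p A B t with hZ
  set Y : ι → Matrix (m ⊕ n) (m ⊕ n) ℝ := fun t => θ • Matrix.hermitianDilation (Z t) with hY
  have hYH (t : ι) : (Y t).IsHermitian := by
    have := Matrix.isHermitian_hermitianDilation (Z t)
    rw [hY, Matrix.IsHermitian, Matrix.conjTranspose_smul, this.eq, star_trivial]
  have hY1 (t : ι) : ‖Y t‖ ≤ 1 := by
    have h1 := (Matrix.norm_hermitianDilation_le (Z t)).trans
      (norm_sub_rowEstimator_le hp hp1 hL.le h t)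
    rw [hY, norm_smul, Real.norm_of_nonneg hθ0.le]
    calc _ ≤ θ * L := by gcongr
      _ = ε / 5 := by rw [hθ]; field_simp
      _ ≤ 1 := by linarith
  have hZ0 : ∑ t, p t • Z t = 0 := by
    simp only [hZ, smul_sub, Finset.sum_sub_distrib, sum_smul_rowEstimator h, ← Finset.sum_smul,
      hp1, one_smul, sub_self]
  have hY0 : ∑ t, p t • Y t = 0 := by
    simp only [hY, smul_comm _ θ, ← Finset.smul_sum, ← map_smul, ← map_sum, hZ0, map_zero, smul_zero]
  have hYv : ∑ t, p t • Y t ^ 2 ≤ (θ ^ 2 * L) • 1 := by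
    -- The hypothesis is symmetric in `A` and `B`; exchanging them bounds the other diagonal block.
    have h' : ∀ t, (B.row t ⬝ᵥ B.row t) + (A.row t ⬝ᵥ A.row t) ≤ L * p t := fun t => by linarith [h t]
    have h1 := sum_smul_sub_rowEstimator_mul_transpose_le hp hp1 h hL.le hA
    have h2 := sum_smul_sub_rowEstimator_mul_transpose_le hp hp1 h' hL.le hB
    have hT (t : ι) : Bᵀ * A - rowEstimator p B A t = (Z t)ᵀ := by
      simp [hZ, Matrix.transpose_sub, Matrix.transpose_mul, rowEstimator_transpose]
    simp only [hT, Matrix.transpose_transpose] at h2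
    have e : ∑ t, p t • Y t ^ 2 = θ ^ 2 • Matrix.fromBlocks (∑ t, p t • (Z t * (Z t)ᵀ)) 0 0
        (∑ t, p t • ((Z t)ᵀ * Z t)) := by
      have hsum : ∀ s : Finset ι, ∑ t ∈ s, p t • Matrix.fromBlocks (Z t * (Z t)ᵀ) 0 0 ((Z t)ᵀ * Z t)
          = Matrix.fromBlocks (∑ t ∈ s, p t • (Z t * (Z t)ᵀ)) 0 0
            (∑ t ∈ s, p t • ((Z t)ᵀ * Z t)) := by
        classical
        intro s
        induction s using Finset.induction_on with
        | empty => simp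
        | insert a s ha ih =>
          rw [Finset.sum_insert ha, Finset.sum_insert ha, Finset.sum_insert ha, ih,
            Matrix.fromBlocks_smul, Matrix.fromBlocks_add]
          simp
      simp only [hY, smul_pow, Matrix.hermitianDilation_sq, smul_comm _ (θ ^ 2), ← Finset.smul_sum,
        hsum]
    rw [e, mul_smul]
    exact smul_le_smul_of_nonneg_left (Matrix.fromBlocks_le_smul_one h1 h2) (sq_nonneg θ)
  have key := Matrix.sum_prod_filter_norm_sum_le hp hp1 hYH hY1 hY0 hYv r (θ * (r * ε))
  have hsub : (Finset.univ.filter fun t : Fin r → ι =>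
      ε < ‖Aᵀ * B - (r : ℝ)⁻¹ • ∑ j, rowEstimator p A B (t j)‖) ⊆
      Finset.univ.filter fun t : Fin r → ι => θ * (r * ε) < ‖∑ j, Y (t j)‖ := by
    intro t ht
    rw [Finset.mem_filter] at ht ⊢
    refine ⟨ht.1, ?_⟩
    have e : Aᵀ * B - (r : ℝ)⁻¹ • ∑ j, rowEstimator p A B (t j) = (r : ℝ)⁻¹ • ∑ j, Z (t j) := by
      simp only [hZ, Finset.sum_sub_distrib, smul_sub, Finset.sum_const, Finset.card_univ,
        Fintype.card_fin, ← Nat.cast_smul_eq_nsmul ℝ, smul_smul, inv_mul_cancel₀ hr'.ne', one_smul]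
    have h2 := ht.2
    rw [e, norm_smul, norm_inv, Real.norm_of_nonneg hr'.le, lt_inv_mul_iff₀ hr'] at h2
    simp only [hY, ← Finset.smul_sum, ← map_sum]
    rw [norm_smul, Real.norm_of_nonneg hθ0.le]
    gcongr
    exact h2.trans_le (Matrix.norm_le_norm_hermitianDilation _)
  have hd : (0 : ℝ) < (Fintype.card m : ℝ) + Fintype.card n := by
    have : (0 : ℝ) < Fintype.card m := by exact_mod_cast Fintype.card_pos
    positivity
  calc _ ≤ _ := Finset.sum_le_sum_of_subset_of_nonneg hsub
        fun t _ _ => Finset.prod_nonneg fun _ _ => hp _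
    _ ≤ _ := key
    _ ≤ 2 * ((Fintype.card m : ℝ) + Fintype.card n) *
        Real.exp (-Real.log (2 * ((Fintype.card m : ℝ) + Fintype.card n) / δ)) := by
        rw [Fintype.card_sum, Nat.cast_add]
        gcongr
        have e : r * (θ ^ 2 * L) - θ * (r * ε) = -(4 / 25 * (r * (ε ^ 2 / L))) := by
          rw [hθ]; field_simp; ring
        have h3 : Real.log (2 * ((Fintype.card m : ℝ) + Fintype.card n) / δ)
            ≤ 1 / 8 * (r * (ε ^ 2 / L)) := by
          have := mul_le_mul_of_nonneg_right hr (show 0 ≤ ε ^ 2 / L by positivity)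
          have e2 : 8 * L / ε ^ 2 * Real.log (2 * ((Fintype.card m : ℝ) + Fintype.card n) / δ)
              * (ε ^ 2 / L) = 8 * Real.log (2 * ((Fintype.card m : ℝ) + Fintype.card n) / δ) := by
            field_simp
          linarith
        have h4 : 0 ≤ r * (ε ^ 2 / L) := by positivity
        rw [e]; linarith
    _ = δ := by
        rw [Real.exp_neg, Real.exp_log (by positivity)]; field_simp
end Sampling

/-! ### Reduction to normalized factors and the final theorem -/

section Main
open scoped MatrixOrder

lemma Matrix.transpose_mul_self_le {m n : Type*} [Fintype m] [Fintype n] [DecidableEq n]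
    (M : Matrix m n ℝ) : Mᵀ * M ≤ ‖M‖ ^ 2 • 1 := by
  rw [Matrix.le_iff]
  refine .of_dotProduct_mulVec_nonneg ?_ fun x => ?_
  · simp [Matrix.IsHermitian, Matrix.transpose_sub, Matrix.transpose_mul]
  · have h := M.mulVec_dotProduct_mulVec_le x
    have e : x ⬝ᵥ (Mᵀ * M) *ᵥ x = M *ᵥ x ⬝ᵥ M *ᵥ x := by
      rw [← Matrix.mulVec_mulVec, Matrix.dotProduct_mulVec, Matrix.vecMul_transpose]
    rw [star_trivial, Matrix.sub_mulVec, dotProduct_sub, e, Matrix.smul_mulVec, dotProduct_smul,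
      Matrix.one_mulVec, smul_eq_mul]
    linarith

lemma rowSamplingMatrix_mul {m r d : ℕ} (p : Fin m → ℝ) (t : Fin r → Fin m)
    (A : Matrix (Fin m) (Fin d) ℝ) (j : Fin r) (i : Fin d) :
    (rowSamplingMatrix p t * A) j i = 1 / √((r : ℝ) * p (t j)) * A (t j) i := by
  simp [rowSamplingMatrix, Matrix.mul_apply, Pi.single_apply]

lemma rowSamplingMatrix_mul_transpose_mul {m r d₁ d₂ : ℕ} {p : Fin m → ℝ} (hp : ∀ t, 0 ≤ p t)
    (t : Fin r → Fin m) (A : Matrix (Fin m) (Fin d₁) ℝ) (B : Matrix (Fin m) (Fin d₂) ℝ) :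
    (rowSamplingMatrix p t * A)ᵀ * (rowSamplingMatrix p t * B)
      = (r : ℝ)⁻¹ • ∑ j, rowEstimator p A B (t j) := by
  ext i k
  rw [Matrix.mul_apply, Matrix.smul_apply, Matrix.sum_apply, smul_eq_mul, Finset.mul_sum]
  refine Finset.sum_congr rfl fun j _ => ?_
  have h0 : (0 : ℝ) ≤ r * p (t j) := mul_nonneg r.cast_nonneg (hp _)
  -- This holds even when `p (t j) = 0`, both sides then being zero.
  have hsq : (1 / √((r : ℝ) * p (t j))) * (1 / √((r : ℝ) * p (t j))) = (r : ℝ)⁻¹ * (p (t j))⁻¹ := by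
    rw [← mul_inv, div_mul_div_comm, Real.mul_self_sqrt h0, one_mul, one_div]
  rw [Matrix.transpose_apply, rowSamplingMatrix_mul, rowSamplingMatrix_mul, rowEstimator,
    Matrix.smul_apply, Matrix.vecMulVec_apply, smul_eq_mul, Matrix.row, Matrix.row]
  linear_combination (A (t j) i * B (t j) k) * hsq

lemma IsPositiveDiagonal.isSymm {d : ℕ} {S : Matrix (Fin d) (Fin d) ℝ} (hS : IsPositiveDiagonal S) :
    Sᵀ = S := hS.1.isSymm

lemma IsPositiveDiagonal.norm_pos {d : ℕ} [NeZero d] {S : Matrix (Fin d) (Fin d) ℝ}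
    (hS : IsPositiveDiagonal S) : 0 < ‖S‖ := by
  rw [norm_pos_iff]
  rintro rfl
  simpa using hS.2 0

lemma IsPositiveDiagonal.stableRank_pos {d : ℕ} [NeZero d] {S : Matrix (Fin d) (Fin d) ℝ}
    (hS : IsPositiveDiagonal S) : 0 < stableRank S := by
  have h1 := hS.norm_pos
  refine div_pos ?_ (by positivity)
  have h2 (i : Fin d) : 0 < ∑ j, S i j ^ 2 :=
    (pow_pos (hS.2 i) 2).trans_le
      (Finset.single_le_sum (f := fun j => S i j ^ 2) (fun _ _ => sq_nonneg _) (Finset.mem_univ i))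
  exact Finset.sum_pos (fun i _ => h2 i) Finset.univ_nonempty

/-- The matrix `W * S`, scaled by the inverse of the spectral norm of `S`. -/
noncomputable def normalizedProduct {m d : ℕ} (W : Matrix (Fin m) (Fin d) ℝ)
    (S : Matrix (Fin d) (Fin d) ℝ) : Matrix (Fin m) (Fin d) ℝ :=
  ‖S‖⁻¹ • (W * S)

/-- Orthonormality cancels `Wᵀ W`, leaving `SᵀS / ‖S‖²`. -/
lemma IsOrthonormalMatrix.normalizedProduct_transpose_mul_self_le {m d : ℕ} [NeZero d]
    {W : Matrix (Fin m) (Fin d) ℝ} (hW : IsOrthonormalMatrix W) {S : Matrix (Fin d) (Fin d) ℝ}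
    (hS : IsPositiveDiagonal S) :
    (normalizedProduct W S)ᵀ * normalizedProduct W S ≤ 1 := by
  have h0 := hS.norm_pos
  have e : (normalizedProduct W S)ᵀ * normalizedProduct W S = (‖S‖ ^ 2)⁻¹ • (Sᵀ * S) := by
    rw [normalizedProduct, Matrix.transpose_smul, Matrix.smul_mul, Matrix.mul_smul, smul_smul,
      Matrix.transpose_mul, Matrix.mul_assoc, ← Matrix.mul_assoc Wᵀ, hW, Matrix.one_mul, ← mul_inv,
      ← sq]
  rw [e]
  calc _ ≤ (‖S‖ ^ 2)⁻¹ • (‖S‖ ^ 2 • (1 : Matrix (Fin d) (Fin d) ℝ)) :=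
        smul_le_smul_of_nonneg_left S.transpose_mul_self_le (by positivity)
    _ = 1 := by rw [smul_smul, inv_mul_cancel₀ (by positivity), one_smul]

lemma row_normalizedProduct_dotProduct_self {m d : ℕ} (W : Matrix (Fin m) (Fin d) ℝ)
    {S : Matrix (Fin d) (Fin d) ℝ} (hS : IsPositiveDiagonal S) (t : Fin m) :
    (normalizedProduct W S).row t ⬝ᵥ (normalizedProduct W S).row t
      = 1 / ‖S‖ ^ 2 * (W.row t ⬝ᵥ (S ^ 2 *ᵥ W.row t)) := by
  have e : (normalizedProduct W S).row t = ‖S‖⁻¹ • (S *ᵥ W.row t) := by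
    have : S *ᵥ W.row t = W.row t ᵥ* S := by
      conv_lhs => rw [← hS.isSymm, Matrix.mulVec_transpose]
    rw [this]; rfl
  have e2 : S *ᵥ W.row t ⬝ᵥ S *ᵥ W.row t = W.row t ⬝ᵥ (S ^ 2 *ᵥ W.row t) := by
    rw [sq, ← Matrix.mulVec_mulVec, Matrix.dotProduct_mulVec (W.row t), ← Matrix.mulVec_transpose,
      hS.isSymm]
  rw [e, smul_dotProduct, dotProduct_smul, smul_smul, e2, smul_eq_mul, ← mul_inv, ← sq, one_div]

lemma norm_sub_sampled_eq {m r d₁ d₂ : ℕ} [NeZero d₁] [NeZero d₂]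
    (W : Matrix (Fin m) (Fin d₁) ℝ) (V : Matrix (Fin m) (Fin d₂) ℝ)
    {S₁ : Matrix (Fin d₁) (Fin d₁) ℝ} {S₂ : Matrix (Fin d₂) (Fin d₂) ℝ}
    (hS₁ : IsPositiveDiagonal S₁) (hS₂ : IsPositiveDiagonal S₂) {p : Fin m → ℝ}
    (hp : ∀ t, 0 ≤ p t) (t : Fin r → Fin m) :
    ‖S₁ * Wᵀ * V * S₂ - S₁ * Wᵀ * (rowSamplingMatrix p t)ᵀ * rowSamplingMatrix p t * V * S₂‖
      = ‖S₁‖ * ‖S₂‖ * ‖(normalizedProduct W S₁)ᵀ * normalizedProduct V S₂ - (r : ℝ)⁻¹ •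
        ∑ j, rowEstimator p (normalizedProduct W S₁) (normalizedProduct V S₂) (t j)‖ := by
  have h1 := hS₁.norm_pos
  have h2 := hS₂.norm_pos
  rw [← rowSamplingMatrix_mul_transpose_mul hp]
  set Q := rowSamplingMatrix p t
  have e1 : W * S₁ = ‖S₁‖ • normalizedProduct W S₁ := by
    rw [normalizedProduct, smul_smul, mul_inv_cancel₀ h1.ne', one_smul]
  have e2 : V * S₂ = ‖S₂‖ • normalizedProduct V S₂ := by
    rw [normalizedProduct, smul_smul, mul_inv_cancel₀ h2.ne', one_smul]
  have e : S₁ * Wᵀ * V * S₂ - S₁ * Wᵀ * Qᵀ * Q * V * S₂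
      = (W * S₁)ᵀ * (V * S₂) - (Q * (W * S₁))ᵀ * (Q * (V * S₂)) := by
    simp only [Matrix.transpose_mul, hS₁.isSymm, Matrix.mul_assoc]
  rw [e, e1, e2]
  simp only [Matrix.transpose_smul, Matrix.smul_mul, Matrix.mul_smul, ← smul_sub, norm_smul,
    norm_norm]
  ring

end Main

theorem mainTheorem2 {m d₁ d₂ r : ℕ}
    (W : Matrix (Fin m) (Fin d₁) ℝ) (V : Matrix (Fin m) (Fin d₂) ℝ)
    (hW : IsOrthonormalMatrix W) (hV : IsOrthonormalMatrix V)
    (S₁ : Matrix (Fin d₁) (Fin d₁) ℝ) (S₂ : Matrix (Fin d₂) (Fin d₂) ℝ)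
    (hS₁ : IsPositiveDiagonal S₁) (hS₂ : IsPositiveDiagonal S₂)
    (β ε δ : ℝ) (hβ : 0 < β) (hε : 0 < ε) (hε' : ε ≤ 3 * √2) (hδ : 0 < δ)
    -- sampling probabilities
    (p : Fin m → ℝ) (hp_nonneg : ∀ t, 0 ≤ p t) (hp_sum : ∑ t, p t = 1)
    (hp : ∀ t, β * ((1 / ‖S₁‖ ^ 2 * (W.row t ⬝ᵥ (S₁ ^ 2 *ᵥ W.row t))
        + 1 / ‖S₂‖ ^ 2 * (V.row t ⬝ᵥ (S₂ ^ 2 *ᵥ V.row t)))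
          / (stableRank S₁ + stableRank S₂)) ≤ p t)
    (hr : 8 * (stableRank S₁ + stableRank S₂) / (β * ε ^ 2)
        * Real.log (2 * ((d₁ : ℝ) + (d₂ : ℝ)) / δ) ≤ (r : ℝ))
    -- the `r` sampled row indices: independent, each distributed according to `p`
    {Ω : Type*} [MeasurableSpace Ω] (μ : Measure Ω) [IsProbabilityMeasure μ]
    (T : Fin r → Ω → Fin m) (hT_meas : ∀ j, Measurable (T j))
    (hT_indep : iIndepFun T μ) (hT_law : ∀ j t, μ.real {ω | T j ω = t} = p t)
    (Q : Ω → Matrix (Fin r) (Fin m) ℝ)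
    (hQ : ∀ ω, Q ω = rowSamplingMatrix p (fun j => T j ω)) :
    1 - δ ≤ μ.real {ω | ‖S₁ * Wᵀ * V * S₂ - S₁ * Wᵀ * (Q ω)ᵀ * Q ω * V * S₂‖
      ≤ ε * ‖S₁‖ * ‖S₂‖} := by
  -- In an empty dimension the error matrix is zero and the event is certain; the norms and stable
  -- ranks are positive only otherwise.
  rcases Nat.eq_zero_or_pos d₁ with rfl | hd₁
  · have h0 (M : Matrix (Fin 0) (Fin d₂) ℝ) : ‖M‖ = 0 := by rw [Subsingleton.elim M 0, norm_zero]
    have h1 : ∀ ω, ‖S₁ * Wᵀ * V * S₂ - S₁ * Wᵀ * (Q ω)ᵀ * Q ω * V * S₂‖ ≤ ε * ‖S₁‖ * ‖S₂‖ :=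
      fun ω => by rw [h0]; positivity
    exact (sub_le_self 1 hδ.le).trans_eq
      (probReal_univ.symm.trans (congrArg μ.real (Set.eq_univ_of_forall h1).symm))
  rcases Nat.eq_zero_or_pos d₂ with rfl | hd₂
  · have h0 (M : Matrix (Fin d₁) (Fin 0) ℝ) : ‖M‖ = 0 := by rw [Subsingleton.elim M 0, norm_zero]
    have h1 : ∀ ω, ‖S₁ * Wᵀ * V * S₂ - S₁ * Wᵀ * (Q ω)ᵀ * Q ω * V * S₂‖ ≤ ε * ‖S₁‖ * ‖S₂‖ :=
      fun ω => by rw [h0]; positivity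
    exact (sub_le_self 1 hδ.le).trans_eq
      (probReal_univ.symm.trans (congrArg μ.real (Set.eq_univ_of_forall h1).symm))
  -- For `δ ≥ 1` the bound is void. For `δ < 1` the logarithm is positive, which forces `r > 0`.
  rcases le_or_gt 1 δ with h1δ | hδ1
  · exact le_trans (by linarith) measureReal_nonneg
  have : NeZero d₁ := ⟨hd₁.ne'⟩
  have : NeZero d₂ := ⟨hd₂.ne'⟩
  have hρ : 0 < stableRank S₁ + stableRank S₂ := add_pos hS₁.stableRank_pos hS₂.stableRank_pos
  -- With this `L` the sampling condition is exactly `|a_t|² + |b_t|² ≤ L p_t` for the normalized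
  -- rows.
  set L := (stableRank S₁ + stableRank S₂) / β with hLdef
  have hL : 0 < L := by positivity
  set A := normalizedProduct W S₁ with hA
  set B := normalizedProduct V S₂ with hB
  have hAB : ∀ t, (A.row t ⬝ᵥ A.row t) + (B.row t ⬝ᵥ B.row t) ≤ L * p t := by
    intro t
    have h := mul_le_mul_of_nonneg_left (hp t) hL.le
    rw [← row_normalizedProduct_dotProduct_self W hS₁, ← row_normalizedProduct_dotProduct_self V hS₂,
      ← hA, ← hB] at h
    refine le_trans (le_of_eq ?_) h
    rw [hLdef]; field_simp
  have hlog : 0 < Real.log (2 * ((d₁ : ℝ) + (d₂ : ℝ)) / δ) := by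
    apply Real.log_pos
    have h1 : (1 : ℝ) ≤ d₁ := by exact_mod_cast hd₁
    have h2 : (1 : ℝ) ≤ d₂ := by exact_mod_cast hd₂
    rw [lt_div_iff₀ hδ]; linarith
  have hr0 : 0 < r := by
    have : (0 : ℝ) < r := lt_of_lt_of_le (by positivity) hr
    exact_mod_cast this
  -- The hypothesis `ε ≤ 3√2` enters only through this weaker bound.
  have hε5 : ε ≤ 5 := by
    have h2 : √2 ≤ 5 / 3 := Real.sqrt_le_iff.2 ⟨by norm_num, by norm_num⟩
    linarith
  have hr' : 8 * L / ε ^ 2 * Real.log (2 * ((Fintype.card (Fin d₁) : ℝ) + Fintype.card (Fin d₂)) / δ)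
      ≤ r := by
    rw [Fintype.card_fin, Fintype.card_fin]
    refine le_trans (le_of_eq ?_) hr
    rw [hLdef]; field_simp
  have key := sum_prod_filter_norm_sub_average_le hp_nonneg hp_sum hAB hL
    (hW.normalizedProduct_transpose_mul_self_le hS₁) (hV.normalizedProduct_transpose_mul_self_le hS₂)
    hε hε5 hδ hr0 hr'
  have hmeas := hT_indep.measureReal_mem_eq_sum hT_meas (Finset.univ.filter fun t : Fin r → Fin m =>
    ε < ‖Aᵀ * B - (r : ℝ)⁻¹ • ∑ j, rowEstimator p A B (t j)‖)
  simp only [hT_law] at hmeas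
  rw [← hmeas] at key
  have hset : {ω | ‖S₁ * Wᵀ * V * S₂ - S₁ * Wᵀ * (Q ω)ᵀ * Q ω * V * S₂‖ ≤ ε * ‖S₁‖ * ‖S₂‖}
      = {ω | (fun j => T j ω) ∈ Finset.univ.filter fun t : Fin r → Fin m =>
        ε < ‖Aᵀ * B - (r : ℝ)⁻¹ • ∑ j, rowEstimator p A B (t j)‖}ᶜ := by
    ext ω
    have h1 := hS₁.norm_pos
    have h2 := hS₂.norm_pos
    rw [Set.mem_ofPred_eq, hQ, norm_sub_sampled_eq W V hS₁ hS₂ hp_nonneg, mul_assoc ε, mul_comm ε,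
      mul_le_mul_iff_right₀ (by positivity)]
    simp [hA, hB]
  have hms : MeasurableSet {ω | (fun j => T j ω) ∈ Finset.univ.filter fun t : Fin r → Fin m =>
      ε < ‖Aᵀ * B - (r : ℝ)⁻¹ • ∑ j, rowEstimator p A B (t j)‖} :=
    measurable_pi_lambda _ hT_meas (Finset.measurableSet _)
  rw [hset, probReal_compl_eq_one_sub hms]
  linarith
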